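/- Let $p$ be a prime and let $G$ be a finite group of order $p^6$ whose nilpotence class is at least $3$. For an irreducible complex character $\chi$ of $G$, let $\ker\chi=\{g\in G:\chi(g)=\chi(1)\}$ and let $\operatorname{cod}(\chi)=|G:\ker\chi|/\chi(1)$ be its codegree; let $\operatorname{cod}(G)=\{\operatorname{cod}(\chi):\chi\in\operatorname{Irr}(G)\}$. Then $p^2\in\operatorname{cod}(G)$. -/

import Mathlib

namespace Codegree

/-- An endomorphism of finite order of a finite-dimensional complex space whose trace is the
dimension is the identity. -/
theorem eq_one_of_trace_eq_finrank {V : Type*} [AddCommGroup V] [Module ℂ V]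
    [FiniteDimensional ℂ V] (f : Module.End ℂ V) {n : ℕ} (hn : n ≠ 0) (hf : f ^ n = 1)
    (ht : LinearMap.trace ℂ V f = Module.finrank ℂ V) : f = 1 := by
  have hroot : ∀ μ ∈ f.charpoly.roots, ‖μ‖ = 1 := by
    intro μ hμ
    have hev : f.HasEigenvalue μ := by
      rw [Module.End.hasEigenvalue_iff_isRoot_charpoly]
      exact Polynomial.isRoot_of_mem_roots hμ
    obtain ⟨v, hv⟩ := hev.exists_hasEigenvector
    have h1 := hv.pow_apply n
    rw [hf, Module.End.one_apply] at h1
    have h2 : (μ ^ n - 1) • v = 0 := by rw [sub_smul, ← h1, one_smul, sub_self]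
    have h3 : μ ^ n = 1 := by
      rcases smul_eq_zero.1 h2 with h | h
      · exact sub_eq_zero.1 h
      · exact absurd h hv.2
    exact Complex.norm_eq_one_of_pow_eq_one h3 hn
  have hsplit : f.charpoly.Splits := IsAlgClosed.splits _
  have hcard : Multiset.card f.charpoly.roots = Module.finrank ℂ V := by
    rw [IsAlgClosed.card_roots_eq_natDegree, LinearMap.charpoly_natDegree]
  have hsum : f.charpoly.roots.sum = Multiset.card f.charpoly.roots := by
    rw [hcard, ← ht, Module.End.trace_eq_sum_roots_charpoly_of_splits hsplit]
  have hone : ∀ μ ∈ f.charpoly.roots, μ = 1 := by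
    have hz : (f.charpoly.roots.map fun μ => 1 - μ.re).sum = 0 := by
      have h1 : ∀ s : Multiset ℂ,
          (s.map fun μ => 1 - μ.re).sum = (Multiset.card s : ℝ) - s.sum.re := by
        intro s
        induction s using Multiset.induction_on with
        | empty => simp
        | cons a s ih => simp [ih]; ring
      rw [h1, hsum]
      simp
    intro μ hμ
    have hre : 1 - μ.re = 0 := by
      refine Multiset.all_zero_of_le_zero_le_of_sum_eq_zero ?_ hz _
        (Multiset.mem_map_of_mem (fun μ : ℂ => 1 - μ.re) hμ)
      intro x hx
      obtain ⟨ν, hν, rfl⟩ := Multiset.mem_map.1 hx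
      have := Complex.re_le_norm ν
      rw [hroot ν hν] at this
      linarith
    have hn1 := hroot μ hμ
    have h4 : μ.re * μ.re + μ.im * μ.im = 1 := by
      rw [← Complex.normSq_apply, Complex.normSq_eq_norm_sq, hn1, one_pow]
    have hre1 : μ.re = 1 := by linarith
    rw [hre1] at h4
    have him : μ.im = 0 := mul_self_eq_zero.1 (by linarith)
    exact Complex.ext hre1 him
  have hchar : f.charpoly = (Polynomial.X - Polynomial.C 1) ^ Module.finrank ℂ V := by
    have h := hsplit.eq_prod_roots_of_monic f.charpoly_monic
    rw [Multiset.eq_replicate_of_mem hone, hcard] at h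
    simpa using h
  have hdvd1 : minpoly ℂ f ∣ Polynomial.X ^ n - 1 := by
    apply minpoly.dvd
    simp [hf]
  have hsq : Squarefree (minpoly ℂ f) :=
    (Polynomial.X_pow_sub_one_separable_iff.2 (Nat.cast_ne_zero.2 hn)).squarefree.squarefree_of_dvd
      hdvd1
  have hdvd2 : minpoly ℂ f ∣ (Polynomial.X - Polynomial.C 1) ^ (Module.finrank ℂ V + 1) := by
    rw [pow_succ, ← hchar]
    exact (LinearMap.minpoly_dvd_charpoly f).mul_right _
  obtain ⟨q, hq⟩ := (hsq.dvd_pow_iff_dvd (Nat.succ_ne_zero _)).1 hdvd2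
  have h5 := congrArg (Polynomial.aeval f) hq
  rw [map_mul, minpoly.aeval, zero_mul] at h5
  simpa [sub_eq_zero] using h5

/-- `Irr G`: the set of irreducible complex characters of `G`. -/
def Irr (G : Type*) [Group G] : Set (G → ℂ) :=
  {χ | ∃ (V : Type) (_ : AddCommGroup V) (_ : Module ℂ V) (_ : FiniteDimensional ℂ V)
      (ρ : Representation ℂ G V), ρ.IsIrreducible ∧ χ = ρ.character}

variable {G : Type*} [Group G]

theorem character_eq_iff_mem_ker [Finite G] {V : Type*} [AddCommGroup V] [Module ℂ V]
    [FiniteDimensional ℂ V] (ρ : Representation ℂ G V) (g : G) :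
    ρ.character g = ρ.character 1 ↔ g ∈ MonoidHom.ker ρ := by
  rw [MonoidHom.mem_ker]
  constructor
  · intro h
    refine eq_one_of_trace_eq_finrank (ρ g) (n := Nat.card G) Nat.card_pos.ne' ?_ ?_
    · rw [← map_pow, pow_card_eq_one', map_one]
    · rwa [Representation.char_one] at h
  · intro h
    simp only [Representation.character, h, map_one]

theorem exists_ker_eq [Finite G] (χ : Irr G) :
    ∃ K : Subgroup G, ∀ g, g ∈ K ↔ χ.1 g = χ.1 1 := by
  obtain ⟨χ, V, _, _, _, ρ, -, rfl⟩ := χ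
  exact ⟨MonoidHom.ker ρ, fun g => (character_eq_iff_mem_ker ρ g).symm⟩

/-- The kernel `{g | χ g = χ 1}` of an irreducible character of a finite group. -/
def ker [Finite G] (χ : Irr G) : Subgroup G where
  carrier := {g | χ.1 g = χ.1 1}
  one_mem' := rfl
  mul_mem' := by
    obtain ⟨K, hK⟩ := exists_ker_eq χ
    intro a b ha hb
    exact (hK _).1 (K.mul_mem ((hK _).2 ha) ((hK _).2 hb))
  inv_mem' := by
    obtain ⟨K, hK⟩ := exists_ker_eq χ
    intro a ha
    exact (hK _).1 (K.inv_mem ((hK _).2 ha))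

/-- The codegree `|G : ker χ| / χ(1)`. The degree `χ(1)` is never zero, so the quotient is
the genuine one. -/
noncomputable def codegree [Finite G] (χ : Irr G) : ℂ :=
  ((ker χ).index : ℂ) / χ.1 1

/-- `cod(G)`: the set of codegrees of the irreducible characters of `G`. -/
def cod (G : Type*) [Group G] [Finite G] : Set ℂ :=
  Set.range (codegree : Irr G → ℂ)

end Codegree

open scoped MonoidAlgebra commutatorElement IsMulCommutative

namespace Codegree

/-! ### Irreducible characters and codegrees -/

section Representations

variable {G : Type*} [Group G]

/-! Write G' for the commutator subgroup and γ₃ = [G', G]. There are two sources of the codegree p².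
If some p-th power lies outside G', then G has a linear character whose image has order p².
Otherwise G/G' has exponent dividing p, and it is enough to find a nonabelian quotient of order p³:
a faithful irreducible character of it has degree p, and inflation keeps the codegree p³/p.

The quotient comes from `hasNonabelianQuotientOfCard_of_relIndex`. Choose a normal M with γ₃ ≤ M ≤
G' and |G' : M| = p. If G/M has an abelian subgroup of index p, its centre has index p². If that
centre also has exponent dividing p, a subgroup of index p in it avoiding the image of G' is normal
in G/M and has index p³.

Class at least 3 means γ₃ ≠ 1, and for |G| = p⁶ this leaves few orders. If |G'| = p⁴, then G/M
itself has order p³. If |G'| = p², then |γ₃| = p and the centralizer of a noncentral element of G'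
supplies the subgroup of index p. If |G'| = p³ and |γ₃| = p², factoring out a suitable subgroup of
γ₃ reduces to the previous configuration. If |G'| = p³ and |γ₃| = p, some U of index p is abelian
modulo γ₃, and the choice of M depends on whether U centralizes G'. -/

theorem ofModule'_apply {Q M : Type*} [Group Q] [AddCommGroup M] [Module ℂ M] [Module ℂ[Q] M]
    [IsScalarTower ℂ ℂ[Q] M] (g : Q) (x : M) :
    Representation.ofModule' (k := ℂ) (G := Q) M g x = MonoidAlgebra.of ℂ Q g • x := by
  simp [Representation.ofModule']

theorem isIrreducible_ofModule' {Q M : Type*} [Group Q] [AddCommGroup M] [Module ℂ M]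
    [Module ℂ[Q] M] [IsScalarTower ℂ ℂ[Q] M] [hM : IsSimpleModule ℂ[Q] M] :
    (Representation.ofModule' (k := ℂ) (G := Q) M).IsIrreducible := by
  have := IsSimpleModule.nontrivial ℂ[Q] M
  refine (isSimpleOrder_iff _).2 ⟨⟨⊥, ⊤, fun h => ?_⟩, fun W => ?_⟩
  · exact bot_ne_top (α := Submodule ℂ M) (congrArg Subrepresentation.toSubmodule h)
  · let W' : Submodule ℂ[Q] M :=
      { W.toSubmodule with
        smul_mem' := fun r x hx => by
          change r • x ∈ W.toSubmodule
          induction r using MonoidAlgebra.induction_on with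
          | of g => rw [← ofModule'_apply]; exact W.apply_mem_toSubmodule g hx
          | add r s hr hs => rw [add_smul]; exact add_mem hr hs
          | smul a r hr => rw [smul_assoc]; exact W.toSubmodule.smul_mem a hr }
    rcases eq_bot_or_eq_top W' with h | h
    · left
      apply Subrepresentation.toSubmodule_injective
      ext x
      exact SetLike.ext_iff.1 h x
    · right
      apply Subrepresentation.toSubmodule_injective
      ext x
      exact SetLike.ext_iff.1 h x

/-- Irreducible complex representations separate the points of a finite group. -/
theorem exists_isIrreducible_apply_ne_one {Q : Type} [Group Q] [Finite Q] {c : Q} (hc : c ≠ 1) :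
    ∃ (V : Type) (_ : AddCommGroup V) (_ : Module ℂ V) (_ : FiniteDimensional ℂ V)
      (ρ : Representation ℂ Q V), ρ.IsIrreducible ∧ ρ c ≠ 1 := by
  by_contra! H
  have key : ∀ x ∈ sSup {m : Submodule ℂ[Q] ℂ[Q] | IsSimpleModule ℂ[Q] m},
      MonoidAlgebra.of ℂ Q c * x = x := by
    intro x hx
    rw [sSup_eq_iSup'] at hx
    induction hx using Submodule.iSup_induction' with
    | mem i x hx =>
      have hfd : FiniteDimensional ℂ i.1 :=
        FiniteDimensional.finiteDimensional_submodule (i.1.restrictScalars ℂ)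
      have h1 := H i.1 _ _ hfd _ (isIrreducible_ofModule' (hM := i.2))
      have h2 := ofModule'_apply c (⟨x, hx⟩ : i.1)
      rw [h1] at h2
      exact (congrArg Subtype.val h2).symm
    | zero => exact mul_zero _
    | add x y _ _ hx hy => rw [mul_add, hx, hy]
  -- By Maschke's theorem the simple left ideals span the group algebra, so `c` fixes 1 itself.
  have h0 := key 1 (by rw [IsSemisimpleModule.sSup_simples_eq_top]; trivial)
  rw [mul_one, ← map_one (MonoidAlgebra.of ℂ Q)] at h0
  exact hc (MonoidAlgebra.of_injective h0)

/-- Subrepresentations of a representation inflated along a surjection. -/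
def subrepresentationCompOrderIso {Q V : Type*} [Group Q] [AddCommGroup V] [Module ℂ V]
    (ρ : Representation ℂ Q V) (f : G →* Q) (hf : Function.Surjective f) :
    Subrepresentation (ρ.comp f : Representation ℂ G V) ≃o Subrepresentation ρ where
  toFun W := ⟨W.toSubmodule, fun q v hv => by
    obtain ⟨g, rfl⟩ := hf q
    exact W.apply_mem_toSubmodule g hv⟩
  invFun W := ⟨W.toSubmodule, fun g _ hv => W.apply_mem_toSubmodule (f g) hv⟩
  left_inv _ := rfl
  right_inv _ := rfl
  map_rel_iff' := Iff.rfl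

theorem isIrreducible_comp {Q V : Type*} [Group Q] [AddCommGroup V] [Module ℂ V]
    {ρ : Representation ℂ Q V} (hρ : ρ.IsIrreducible) {f : G →* Q}
    (hf : Function.Surjective f) :
    Representation.IsIrreducible (ρ.comp f : Representation ℂ G V) :=
  (OrderIso.isSimpleOrder_iff (subrepresentationCompOrderIso ρ f hf)).2 hρ

theorem index_ker_div_finrank_mem_cod [Finite G] {V : Type} [AddCommGroup V] [Module ℂ V]
    [FiniteDimensional ℂ V] (ρ : Representation ℂ G V) (hρ : ρ.IsIrreducible) :
    ((MonoidHom.ker ρ).index : ℂ) / Module.finrank ℂ V ∈ cod G := by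
  refine ⟨⟨ρ.character, V, _, _, ‹_›, ρ, hρ, rfl⟩, ?_⟩
  have hker : ker (⟨ρ.character, V, _, _, ‹_›, ρ, hρ, rfl⟩ : Irr G) = MonoidHom.ker ρ := by
    ext g
    exact character_eq_iff_mem_ker ρ g
  rw [codegree, hker]
  simp only [Representation.char_one]

/-- An operator commuting with an irreducible complex representation is a scalar. -/
theorem exists_eq_smul_one_of_commute {V : Type*} [AddCommGroup V] [Module ℂ V]
    [FiniteDimensional ℂ V] {ρ : Representation ℂ G V} (hρ : ρ.IsIrreducible)
    (T : Module.End ℂ V) (hT : ∀ g, T * ρ g = ρ g * T) : ∃ a : ℂ, T = a • 1 := by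
  obtain ⟨hnt, hsimp⟩ := (isSimpleOrder_iff _).1 hρ
  have hV : Nontrivial V := by
    by_contra hV
    rw [not_nontrivial_iff_subsingleton] at hV
    obtain ⟨A, B, hAB⟩ := hnt
    exact hAB (Subrepresentation.toSubmodule_injective (Subsingleton.elim _ _))
  obtain ⟨a, ha⟩ := Module.End.exists_eigenvalue T
  refine ⟨a, ?_⟩
  let W : Subrepresentation ρ := ⟨T.eigenspace a, fun g v hv => by
    rw [Module.End.mem_eigenspace_iff] at hv ⊢
    have := LinearMap.congr_fun (hT g) v
    simp only [Module.End.mul_apply] at this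
    rw [this, hv, map_smul]⟩
  rcases hsimp W with h | h
  · refine absurd (congrArg Subrepresentation.toSubmodule h) ha
  · ext v
    have hv : v ∈ W := by rw [h]; trivial
    exact Module.End.mem_eigenspace_iff.1 hv

/-- A faithful irreducible character of a finite group of class at most two is fully ramified
over the centre. -/
theorem finrank_sq_mul_card_center [Finite G] {V : Type*} [AddCommGroup V] [Module ℂ V]
    [FiniteDimensional ℂ V] {ρ : Representation ℂ G V} (hρ : ρ.IsIrreducible)
    (hinj : Function.Injective ρ) (hcl : ∀ g h : G, ⁅g, h⁆ ∈ Subgroup.center G) :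
    Module.finrank ℂ V ^ 2 * Nat.card (Subgroup.center G) = Nat.card G := by
  classical
  have := Fintype.ofFinite G
  have hne : (Nat.card G : ℂ) ≠ 0 := Nat.cast_ne_zero.2 Nat.card_pos.ne'
  have : Invertible (Nat.card G : ℂ) := invertibleOfNonzero hne
  have hscalar : ∀ z ∈ Subgroup.center G, ∃ a : ℂ, ρ z = a • 1 := fun z hz =>
    exists_eq_smul_one_of_commute hρ _ fun g => by
      rw [← map_mul, ← map_mul, Subgroup.mem_center_iff.1 hz g]
  -- Conjugating `g` multiplies it by a central commutator, which acts as a scalar different from 1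
  -- by faithfulness; the character value must vanish.
  have hoff : ∀ g ∉ Subgroup.center G, ρ.character g = 0 := by
    intro g hg
    rw [Subgroup.mem_center_iff] at hg
    push Not at hg
    obtain ⟨h, hh⟩ := hg
    obtain ⟨a, ha⟩ := hscalar _ (hcl h g)
    have h1 := ρ.char_conj g h
    have h2 : h * g * h⁻¹ = ⁅h, g⁆ * g := by rw [commutatorElement_def]; group
    rw [h2, Representation.character, Representation.character, map_mul, ha, smul_mul_assoc,
      one_mul, map_smul, smul_eq_mul] at h1
    by_contra h0
    have ha1 : a = 1 := mul_right_cancel₀ h0 (by rw [one_mul]; exact h1)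
    rw [ha1, one_smul, ← map_one ρ] at ha
    exact hh (commutatorElement_eq_one_iff_mul_comm.1 (hinj ha))
  have hon : ∀ g ∈ Subgroup.center G,
      ρ.character g * ρ.character g⁻¹ = (Module.finrank ℂ V : ℂ) ^ 2 := by
    intro g hg
    obtain ⟨a, ha⟩ := hscalar g hg
    obtain ⟨b, hb⟩ := hscalar _ (inv_mem hg)
    have h1 : ρ g * ρ g⁻¹ = 1 := by rw [← map_mul, mul_inv_cancel, map_one]
    rw [ha, hb, smul_mul_smul_comm, one_mul] at h1
    have h2 := congrArg (LinearMap.trace ℂ V) h1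
    simp only [map_smul, LinearMap.trace_one, smul_eq_mul] at h2
    simp only [Representation.character, ha, hb, map_smul, LinearMap.trace_one, smul_eq_mul]
    linear_combination (Module.finrank ℂ V : ℂ) * h2
  have horth := Representation.char_orthonormal ρ ρ
  rw [if_pos ⟨Representation.Equiv.refl ρ⟩, inv_mul_eq_iff_eq_mul₀ hne, mul_one,
    ← Finset.sum_subset (Finset.subset_univ (Finset.univ.filter (· ∈ Subgroup.center G)))
      (fun g _ hg => by rw [hoff g (by simpa using hg), zero_mul]),
    Finset.sum_congr rfl (fun g hg => hon g (Finset.mem_filter.1 hg).2), Finset.sum_const,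
    nsmul_eq_mul] at horth
  have hcardc : (Finset.univ.filter (· ∈ Subgroup.center G)).card
      = Nat.card (Subgroup.center G) := by
    rw [Nat.card_eq_fintype_card, Fintype.card_subtype]
  rw [hcardc, mul_comm] at horth
  exact_mod_cast horth

theorem isMulCommutative_of_card_dvd_prime_sq [Finite G] {p : ℕ} (hp : p.Prime)
    (hG : Nat.card G ∣ p ^ 2) : IsMulCommutative G := by
  have : Fact p.Prime := ⟨hp⟩
  obtain ⟨k, hk, hk'⟩ := (Nat.dvd_prime_pow hp).1 hG
  obtain rfl | rfl | rfl : k = 0 ∨ k = 1 ∨ k = 2 := by omega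
  · have := (Nat.card_eq_one_iff_unique.1 (by simpa using hk')).1
    exact ⟨⟨fun _ _ => Subsingleton.elim _ _⟩⟩
  · have := isCyclic_of_prime_card (p := p) (by simpa using hk')
    infer_instance
  · exact IsPGroup.isMulCommutative_of_card_eq_prime_sq hk'

/-- In a group of order `p ^ 3` commutators are central. -/
theorem commutatorElement_mem_center_of_card_eq_prime_pow_three [Finite G] {p : ℕ} (hp : p.Prime)
    (hG : Nat.card G = p ^ 3) (g h : G) : ⁅g, h⁆ ∈ Subgroup.center G := by
  have : Fact p.Prime := ⟨hp⟩
  have hpg : IsPGroup p G := IsPGroup.of_card hG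
  have hnt : Nontrivial G := by
    rw [← Finite.one_lt_card_iff_nontrivial, hG]
    exact Nat.one_lt_pow (by norm_num) hp.one_lt
  have hc : Nontrivial (Subgroup.center G) := hpg.center_nontrivial
  have hcard := Subgroup.card_mul_index (Subgroup.center G)
  obtain ⟨k, hk, hk'⟩ := (Nat.dvd_prime_pow hp).1 (hG ▸ Subgroup.card_subgroup_dvd_card
    (Subgroup.center G))
  have hk0 : k ≠ 0 := by
    rintro rfl
    rw [← Finite.one_lt_card_iff_nontrivial, hk'] at hc
    simp at hc
  have hcomm := isMulCommutative_of_card_dvd_prime_sq hp (G := G ⧸ Subgroup.center G) (by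
    rw [hk', hG, ← Nat.add_sub_of_le hk, pow_add] at hcard
    rw [← Subgroup.index, Nat.eq_of_mul_eq_mul_left (pow_pos hp.pos k) hcard]
    exact pow_dvd_pow _ (by omega))
  rw [← QuotientGroup.eq_one_iff]
  exact commutatorElement_eq_one_iff_mul_comm.2
    (hcomm.is_comm.comm (g : G ⧸ Subgroup.center G) h)

/-- A surjection onto a nonabelian group of order `p ^ 3` yields the codegree `p ^ 2`. -/
theorem sq_mem_cod_of_surjective [Finite G] {p : ℕ} (hp : p.Prime) {Q : Type} [Group Q]
    (f : G →* Q) (hf : Function.Surjective f) (hQ : Nat.card Q = p ^ 3)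
    (hcomm : ¬ commutator G ≤ f.ker) : (p : ℂ) ^ 2 ∈ cod G := by
  have : Fact p.Prime := ⟨hp⟩
  have : Finite Q := Finite.of_surjective f hf
  obtain ⟨g, h, hgh⟩ : ∃ g h : G, ⁅f g, f h⁆ ≠ 1 := by
    by_contra! H
    refine hcomm ?_
    rw [commutator_def, Subgroup.commutator_le]
    intro g _ h _
    rw [MonoidHom.mem_ker, map_commutatorElement, H]
  obtain ⟨V, _, _, _, ρ, hρ, hne⟩ := exists_isIrreducible_apply_ne_one hgh
  -- A nontrivial kernel would leave a quotient of order dividing p², which is abelian, so the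
  -- chosen commutator would act trivially.
  have hinj : Function.Injective ρ := by
    rw [← MonoidHom.ker_eq_bot_iff, ← Subgroup.card_eq_one]
    obtain ⟨k, hk, hk'⟩ := (Nat.dvd_prime_pow hp).1
      (hQ ▸ Subgroup.card_subgroup_dvd_card (MonoidHom.ker ρ))
    by_contra hk1
    have hk0 : k ≠ 0 := by rintro rfl; exact hk1 hk'
    have hcard := Subgroup.card_mul_index (MonoidHom.ker ρ)
    have := isMulCommutative_of_card_dvd_prime_sq hp (G := Q ⧸ MonoidHom.ker ρ) (by
      rw [hk', hQ, ← Nat.add_sub_of_le hk, pow_add] at hcard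
      rw [← Subgroup.index, Nat.eq_of_mul_eq_mul_left (pow_pos hp.pos k) hcard]
      exact pow_dvd_pow _ (by omega))
    apply hne
    rw [← MonoidHom.mem_ker, ← QuotientGroup.eq_one_iff]
    exact commutatorElement_eq_one_iff_mul_comm.2
      (this.is_comm.comm (f g : Q ⧸ MonoidHom.ker ρ) (f h))
  have hdim := finrank_sq_mul_card_center hρ hinj
    (commutatorElement_mem_center_of_card_eq_prime_pow_three hp hQ)
  have hd : Module.finrank ℂ V = p := by
    obtain ⟨k, hk, hk'⟩ := (Nat.dvd_prime_pow hp).1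
      (hQ ▸ Subgroup.card_subgroup_dvd_card (Subgroup.center Q))
    obtain ⟨d, -, hd⟩ := (Nat.dvd_prime_pow hp).1
      (hQ ▸ hdim ▸ (dvd_pow_self (Module.finrank ℂ V) two_ne_zero).mul_right _)
    rw [hk', hd, hQ, ← pow_mul, ← pow_add] at hdim
    have hdk := Nat.pow_right_injective hp.two_le hdim
    have hk3 : k ≠ 3 := by
      rintro rfl
      have htop : Subgroup.center Q = ⊤ := Subgroup.eq_top_of_card_eq _ (by rw [hk', hQ])
      apply hgh
      rw [commutatorElement_eq_one_iff_mul_comm]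
      exact (Subgroup.mem_center_iff.1 (htop ▸ Subgroup.mem_top (f h)) (f g))
    obtain rfl : d = 1 := by omega
    rw [hd, pow_one]
  have hker : MonoidHom.ker (ρ.comp f) = f.ker := by
    ext x
    rw [MonoidHom.mem_ker, MonoidHom.mem_ker, MonoidHom.comp_apply]
    exact map_eq_one_iff ρ hinj
  have hmem := index_ker_div_finrank_mem_cod (ρ.comp f : Representation ℂ G V)
    (isIrreducible_comp hρ hf)
  have hp0 : (p : ℂ) ≠ 0 := Nat.cast_ne_zero.2 hp.ne_zero
  rwa [hker, Subgroup.index_ker, MonoidHom.range_eq_top.2 hf, Subgroup.card_top, hQ, hd,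
    Nat.cast_pow, pow_succ, mul_div_assoc, div_self hp0, mul_one] at hmem

/-- A nonabelian quotient of order `p ^ 3` contributes the codegree `p ^ 2`. -/
theorem sq_mem_cod_of_index_eq_prime_pow_three [Finite G] {p : ℕ} (hp : p.Prime) (N : Subgroup G)
    [N.Normal] (hN : N.index = p ^ 3) (hcN : ¬ commutator G ≤ N) : (p : ℂ) ^ 2 ∈ cod G := by
  -- `Irr` only admits spaces in `Type`, and the representations are built inside the group algebra,
  -- so the quotient is first moved to universe 0.
  let e : Shrink.{0} (G ⧸ N) ≃* G ⧸ N := Shrink.mulEquiv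
  refine sq_mem_cod_of_surjective hp (e.symm.toMonoidHom.comp (QuotientGroup.mk' N))
    (e.symm.surjective.comp (QuotientGroup.mk'_surjective N)) ?_ ?_
  · rw [Nat.card_congr e.toEquiv, ← hN, Subgroup.index]
  · have hker : (e.symm.toMonoidHom.comp (QuotientGroup.mk' N)).ker = N :=
      (MonoidHom.ker_mulEquiv_comp _ e.symm).trans (QuotientGroup.ker_mk' N)
    rwa [hker]

/-- A linear character of order `p ^ 2` exists unless `G` modulo its commutator subgroup has
exponent dividing `p`. -/
theorem sq_mem_cod_of_pow_notMem_commutator [Finite G] {p : ℕ} (hp : p.Prime)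
    (hG : IsPGroup p G) {x : G} (hx : x ^ p ∉ commutator G) : (p : ℂ) ^ 2 ∈ cod G := by
  have : Fact p.Prime := ⟨hp⟩
  have hne : (Abelianization.of x) ^ p ≠ 1 := by
    rw [← map_pow]
    intro h
    exact hx ((QuotientGroup.eq_one_iff _).1 h)
  obtain ⟨φ, hφ⟩ := CommGroup.exists_apply_ne_one_of_hasEnoughRootsOfUnity (Abelianization G) ℂ hne
  let ψ : G →* ℂˣ := φ.comp Abelianization.of
  have hψ : ψ x ^ p ≠ 1 := by simpa [ψ] using hφ
  have hfin : Finite ψ.range := Finite.of_surjective _ ψ.rangeRestrict_surjective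
  have hcyc : IsCyclic ψ.range := inferInstance
  obtain ⟨n, hn⟩ := IsPGroup.iff_card.1 (hG.of_surjective _ ψ.rangeRestrict_surjective)
  have hn2 : 2 ≤ n := by
    by_contra! hlt
    apply hψ
    have h1 : (⟨ψ x, x, rfl⟩ : ψ.range) ^ Nat.card ψ.range = 1 := pow_card_eq_one'
    have h2 : (⟨ψ x, x, rfl⟩ : ψ.range) ^ p = 1 := by
      obtain rfl | rfl : n = 0 ∨ n = 1 := by omega
      · rw [hn, pow_zero, pow_one] at h1
        rw [h1, one_pow]
      · rwa [hn, pow_one] at h1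
    exact congrArg Subtype.val h2
  -- The image of `ψ` is cyclic of order p^n with n ≥ 2; this power cuts it down to order exactly
  -- p².
  let θ : G →* ℂˣ := (powMonoidHom (p ^ (n - 2))).comp ψ
  have hθ : θ.ker.index = p ^ 2 := by
    have hrange : θ.range = ψ.range.map (powMonoidHom (p ^ (n - 2))) := MonoidHom.range_comp _ _
    obtain ⟨g, hg⟩ := hcyc.exists_generator
    have hord : orderOf g = p ^ n := by rw [orderOf_eq_card_of_forall_mem_zpowers hg, hn]
    have hz : ψ.range = Subgroup.zpowers (g : ℂˣ) := by
      ext y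
      constructor
      · intro hy
        obtain ⟨k, hk⟩ := hg ⟨y, hy⟩
        exact ⟨k, congrArg Subtype.val hk⟩
      · rintro ⟨k, rfl⟩
        exact zpow_mem g.2 k
    rw [Subgroup.index_ker, hrange, hz, MonoidHom.map_zpowers, Nat.card_zpowers,
      powMonoidHom_apply, orderOf_pow' _ (pow_pos hp.pos _).ne', Subgroup.orderOf_coe, hord,
      Nat.gcd_eq_right (pow_dvd_pow _ (Nat.sub_le _ _)), Nat.pow_div (Nat.sub_le _ _) hp.pos,
      Nat.sub_sub_self hn2]
  let ρ : Representation ℂ G ℂ :=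
    ((Algebra.lmul ℂ ℂ : ℂ →* Module.End ℂ ℂ)).comp ((Units.coeHom ℂ).comp θ)
  have hker : MonoidHom.ker ρ = θ.ker := by
    ext g
    rw [MonoidHom.mem_ker, MonoidHom.mem_ker, ← Units.val_inj]
    constructor
    · intro h
      simpa [ρ] using LinearMap.congr_fun h 1
    · intro h
      ext
      simpa [ρ] using h
  have hirr : ρ.IsIrreducible := by
    refine (isSimpleOrder_iff _).2 ⟨⟨⊥, ⊤, fun h => ?_⟩, fun W => ?_⟩
    · exact bot_ne_top (α := Submodule ℂ ℂ) (congrArg Subrepresentation.toSubmodule h)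
    · exact (eq_bot_or_eq_top (α := Submodule ℂ ℂ) W.toSubmodule).imp
        (fun h => Subrepresentation.toSubmodule_injective h)
        (fun h => Subrepresentation.toSubmodule_injective h)
  have hmem := index_ker_div_finrank_mem_cod ρ hirr
  rwa [hker, hθ, Module.finrank_self, Nat.cast_one, div_one, Nat.cast_pow] at hmem

end Representations

/-! ### Commutators, centralizers and subgroups of prime index -/

section Commutators

variable {G : Type*} [Group G]

/-- `G` has a nonabelian quotient of order `p ^ 3`. -/
def HasNonabelianQuotientOfCard (p : ℕ) (G : Type*) [Group G] : Prop :=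
  ∃ N : Subgroup G, N.Normal ∧ N.index = p ^ 3 ∧ ¬ commutator G ≤ N

theorem map_commutator_of_surjective {H : Type*} [Group H] {f : G →* H}
    (hf : Function.Surjective f) : (commutator G).map f = commutator H := by
  rw [commutator_def, commutator_def, Subgroup.map_commutator, Subgroup.map_top_of_surjective f hf]

theorem HasNonabelianQuotientOfCard.of_surjective {p : ℕ} {H : Type*} [Group H] {f : G →* H}
    (hf : Function.Surjective f) (h : HasNonabelianQuotientOfCard p H) :
    HasNonabelianQuotientOfCard p G := by
  obtain ⟨N, hN, hidx, hc⟩ := h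
  refine ⟨N.comap f, hN.comap f, by rw [N.index_comap_of_surjective hf, hidx], fun hle => hc ?_⟩
  rw [← map_commutator_of_surjective hf]
  exact Subgroup.map_le_iff_le_comap.2 hle

theorem eq_top_of_lt_of_index_prime {p : ℕ} (hp : p.Prime) {A B : Subgroup G} (hA : A.index = p)
    (h : A < B) : B = ⊤ := by
  rcases (Nat.dvd_prime hp).1 (hA ▸ Subgroup.index_dvd_of_le h.le) with h1 | h1
  · exact Subgroup.index_eq_one.1 h1
  · have h2 := Subgroup.relIndex_mul_index h.le
    rw [hA, h1] at h2
    exact absurd (Subgroup.relIndex_eq_one.1 (Nat.eq_of_mul_eq_mul_right hp.pos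
      (h2.trans (one_mul p).symm))) (not_le_of_gt h)

theorem exists_notMem_of_index_prime {p : ℕ} (hp : p.Prime) {A : Subgroup G} (hA : A.index = p) :
    ∃ x, x ∉ A := by
  by_contra! h
  have : A = ⊤ := (Subgroup.eq_top_iff' A).2 h
  rw [this, Subgroup.index_top] at hA
  exact hp.one_lt.ne hA

/-- An element commuting with a subgroup of prime index and with an element outside is central. -/
theorem mem_center_of_index_prime {p : ℕ} (hp : p.Prime) {A : Subgroup G} (hA : A.index = p)
    {x c : G} (hx : x ∉ A) (hcA : ∀ a ∈ A, a * c = c * a) (hcx : x * c = c * x) :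
    c ∈ Subgroup.center G := by
  have h : Subgroup.centralizer {c} = ⊤ := by
    refine eq_top_of_lt_of_index_prime hp hA (lt_of_le_of_ne ?_ ?_)
    · intro a ha
      rw [Subgroup.mem_centralizer_singleton_iff]
      exact hcA a ha
    · intro h
      apply hx
      rw [h, Subgroup.mem_centralizer_singleton_iff]
      exact hcx
  rw [Subgroup.mem_center_iff]
  intro g
  have : g ∈ Subgroup.centralizer {c} := h ▸ Subgroup.mem_top g
  exact Subgroup.mem_centralizer_singleton_iff.1 this

theorem center_eq_top_of_index_dvd_prime {p : ℕ} (hp : p.Prime)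
    (h : (Subgroup.center G).index ∣ p) : Subgroup.center G = ⊤ := by
  rcases (Nat.dvd_prime hp).1 h with h1 | h1
  · exact Subgroup.index_eq_one.1 h1
  · obtain ⟨x, hx⟩ := exists_notMem_of_index_prime hp h1
    exact absurd (mem_center_of_index_prime hp h1 hx
      (fun a ha => (Subgroup.mem_center_iff.1 ha x).symm) rfl) hx

/-- S ∩ T is central in T with quotient of order 1 or p, hence cyclic, so T is abelian. -/
theorem commutator_eq_bot_of_relIndex_dvd_prime {p : ℕ} (hp : p.Prime) {S T : Subgroup G}
    (hTS : T ≤ Subgroup.centralizer S) (h : S.relIndex T ∣ p) : ⁅T, T⁆ = ⊥ := by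
  have hle : S.subgroupOf T ≤ Subgroup.center T := by
    intro s hs
    rw [Subgroup.mem_center_iff]
    intro t
    exact Subtype.ext (Subgroup.mem_centralizer_iff.1 (hTS t.2) s hs).symm
  have htop := center_eq_top_of_index_dvd_prime hp ((Subgroup.index_dvd_of_le hle).trans h)
  rw [Subgroup.commutator_eq_bot_iff_le_centralizer]
  intro t ht
  rw [Subgroup.mem_centralizer_iff]
  intro s hs
  have h1 : (⟨t, ht⟩ : T) ∈ Subgroup.center T := htop ▸ Subgroup.mem_top _
  exact congrArg Subtype.val (Subgroup.mem_center_iff.1 h1 ⟨s, hs⟩)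

/-- The homomorphism `b ↦ ⁅w, b⁆` on a subgroup on which it takes values in a central subgroup. -/
def commutatorHom (w : G) {B C : Subgroup G} (hC : C ≤ Subgroup.center G)
    (h : ∀ b ∈ B, ⁅w, b⁆ ∈ C) : B →* C :=
  MonoidHom.mk' (fun b => ⟨⁅w, b⁆, h b b.2⟩) (fun a b => Subtype.ext (by
    have h1 := Subgroup.mem_center_iff.1 (hC (h b b.2)) a
    have h2 : ⁅w, (a * b : G)⁆ = ⁅w, (a : G)⁆ * (a * ⁅w, (b : G)⁆) * (a : G)⁻¹ := by
      simp only [commutatorElement_def]; group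
    change ⁅w, (a * b : G)⁆ = ⁅w, (a : G)⁆ * ⁅w, (b : G)⁆
    rw [h2, h1]; group))

theorem ker_commutatorHom (w : G) {B C : Subgroup G} (hC : C ≤ Subgroup.center G)
    (h : ∀ b ∈ B, ⁅w, b⁆ ∈ C) :
    (commutatorHom w hC h).ker = (Subgroup.centralizer {w}).subgroupOf B := by
  ext b
  rw [MonoidHom.mem_ker, Subgroup.mem_subgroupOf, Subgroup.mem_centralizer_singleton_iff, eq_comm,
    eq_comm (a := (b : G) * w), ← commutatorElement_eq_one_iff_mul_comm, ← Subtype.val_inj, eq_comm]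
  rfl

/-- The index is the size of the image of b ↦ [w, b], a homomorphism because its values are central.
-/
theorem relIndex_centralizer_dvd [Finite G] (w : G) {B C : Subgroup G}
    (hC : C ≤ Subgroup.center G) (h : ∀ b ∈ B, ⁅w, b⁆ ∈ C) :
    (Subgroup.centralizer {w}).relIndex B ∣ Nat.card C := by
  rw [Subgroup.relIndex, ← ker_commutatorHom w hC h, Subgroup.index_ker]
  exact Subgroup.card_subgroup_dvd_card _

theorem index_centralizer_dvd [Finite G] (w : G) {C : Subgroup G}
    (hC : C ≤ Subgroup.center G) (h : ∀ b, ⁅w, b⁆ ∈ C) :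
    (Subgroup.centralizer {w}).index ∣ Nat.card C := by
  rw [← Subgroup.relIndex_top_right]
  exact relIndex_centralizer_dvd w hC fun b _ => h b

/-- An element whose commutators are all central centralizes the commutator subgroup. -/
theorem commutator_le_centralizer_singleton {z : G} (h : ∀ g, ⁅z, g⁆ ∈ Subgroup.center G) :
    commutator G ≤ Subgroup.centralizer {z} := by
  let φ : (⊤ : Subgroup G) →* Subgroup.center G := commutatorHom z le_rfl fun g _ => h g
  rw [commutator_def, Subgroup.commutator_le]
  intro a ha b hb
  have h1 : ⁅(⟨a, ha⟩ : (⊤ : Subgroup G)), ⟨b, hb⟩⁆ ∈ φ.ker := by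
    rw [MonoidHom.mem_ker, map_commutatorElement, commutatorElement_eq_one_iff_mul_comm]
    exact mul_comm' _ _
  rw [ker_commutatorHom] at h1
  exact h1

theorem commutatorElement_pow_left {z g : G} (h : Commute ⁅z, g⁆ z) (n : ℕ) :
    ⁅z ^ n, g⁆ = ⁅z, g⁆ ^ n := by
  have h1 : g * z * g⁻¹ = ⁅z, g⁆⁻¹ * z := by rw [commutatorElement_def]; group
  have h2 : g * z ^ n * g⁻¹ = (⁅z, g⁆ ^ n)⁻¹ * z ^ n := by
    rw [← conj_pow, h1, h.inv_left.mul_pow, inv_pow]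
  calc ⁅z ^ n, g⁆ = z ^ n * (g * z ^ n * g⁻¹)⁻¹ := by rw [commutatorElement_def]; group
    _ = ⁅z, g⁆ ^ n := by rw [h2]; group

theorem commutatorElement_pow_right {z g : G} (h : Commute ⁅z, g⁆ g) (n : ℕ) :
    ⁅z, g ^ n⁆ = ⁅z, g⁆ ^ n := by
  have h1 : Commute ⁅g, z⁆ g := by rw [← commutatorElement_inv]; exact h.inv_left
  rw [← commutatorElement_inv, commutatorElement_pow_left h1, ← commutatorElement_inv z g,
    inv_pow, inv_inv]

theorem normal_of_commutator_le {B M : Subgroup G} (hMB : M ≤ B) (h : ⁅B, ⊤⁆ ≤ M) : M.Normal := by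
  refine ⟨fun m hm g => ?_⟩
  have h1 : ⁅m, g⁆ ∈ M := h (Subgroup.commutator_mem_commutator (hMB hm) (Subgroup.mem_top g))
  have h2 : g * m * g⁻¹ = ⁅m, g⁆⁻¹ * m := by rw [commutatorElement_def]; group
  rw [h2]
  exact mul_mem (inv_mem h1) hm

/-- In a nilpotent group `⁅B, G⁆` is a proper subgroup of a nontrivial normal subgroup `B`. -/
theorem commutator_top_lt [Group.IsNilpotent G] {B : Subgroup G} [B.Normal] (hB : B ≠ ⊥) :
    ⁅B, ⊤⁆ < B := by
  refine lt_of_le_of_ne (Subgroup.commutator_le_left B ⊤) fun h => hB ?_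
  obtain ⟨n, hn⟩ := Subgroup.nilpotent_iff_lowerCentralSeries.1 ‹Group.IsNilpotent G›
  rw [eq_bot_iff, ← hn]
  clear hn
  induction n with
  | zero => exact le_top
  | succ n ih =>
    rw [Subgroup.lowerCentralSeries_succ, ← h]
    exact Subgroup.commutator_mono ih le_rfl

theorem index_eq_pow {p : ℕ} (hp : p.Prime) {A : Subgroup G} {a b : ℕ} (hA : Nat.card A = p ^ a)
    (hG : Nat.card G = p ^ (a + b)) : A.index = p ^ b := by
  have h1 := Subgroup.card_mul_index A
  rw [hA, hG, pow_add] at h1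
  exact Nat.eq_of_mul_eq_mul_left (pow_pos hp.pos a) h1

theorem relIndex_eq_pow {p : ℕ} (hp : p.Prime) {A B : Subgroup G} {a b : ℕ} (hA : Nat.card A = p ^ a)
    (hB : Nat.card B = p ^ (a + b)) (h : A ≤ B) : A.relIndex B = p ^ b := by
  have h1 := Subgroup.card_mul_index (A.subgroupOf B)
  rw [Nat.card_congr (Subgroup.subgroupOfEquivOfLe h).toEquiv, hA, hB, pow_add] at h1
  exact Nat.eq_of_mul_eq_mul_left (pow_pos hp.pos a) h1

/-! ### Subgroups of finite p-groups -/

section PGroup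

variable [Finite G] {p : ℕ}

theorem exists_card_eq_pow (hp : p.Prime) (hG : IsPGroup p G) (K : Subgroup G) :
    ∃ k, Nat.card K = p ^ k := by
  have : Fact p.Prime := ⟨hp⟩
  exact IsPGroup.iff_card.1 (hG.to_subgroup K)

theorem lt_of_card_eq_pow (hp : p.Prime) {A B : Subgroup G} {a b : ℕ} (hA : Nat.card A = p ^ a)
    (hB : Nat.card B = p ^ b) (h : A < B) : a < b := by
  by_contra! hba
  refine h.ne (Subgroup.eq_of_le_of_card_ge h.le ?_)
  rw [hA, hB]
  exact Nat.pow_le_pow_right hp.pos hba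

theorem exists_between_of_card_eq_pow (hp : p.Prime) {A B : Subgroup G} {a m b : ℕ}
    (hA : Nat.card A = p ^ a) (hB : Nat.card B = p ^ b) (h : A ≤ B) (ham : a ≤ m) (hmb : m ≤ b) :
    ∃ M, A ≤ M ∧ M ≤ B ∧ Nat.card M = p ^ m := by
  have : Fact p.Prime := ⟨hp⟩
  obtain ⟨K, hK, hAK⟩ := Sylow.exists_subgroup_card_pow_prime_le p (hB ▸ pow_dvd_pow p hmb)
    (A.subgroupOf B) ((Nat.card_congr (Subgroup.subgroupOfEquivOfLe h).toEquiv).trans hA) ham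
  refine ⟨K.map B.subtype, ?_, Subgroup.map_subtype_le K, ?_⟩
  · intro x hx
    exact ⟨⟨x, h hx⟩, hAK hx, rfl⟩
  · rw [Subgroup.card_map_of_injective B.subtype_injective, hK]

/-- Every subgroup between [B, G] and B is normal, so M can be chosen by its order alone. -/
theorem exists_normal_relIndex_eq_prime (hp : p.Prime) (hG : IsPGroup p G) {A B : Subgroup G}
    (h : A < B) (hc : ⁅B, ⊤⁆ ≤ A) :
    ∃ M : Subgroup G, M.Normal ∧ A ≤ M ∧ M ≤ B ∧ M.relIndex B = p := by
  obtain ⟨a, ha⟩ := exists_card_eq_pow hp hG A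
  obtain ⟨b, hb⟩ := exists_card_eq_pow hp hG B
  have hab := lt_of_card_eq_pow hp ha hb h
  obtain ⟨M, hAM, hMB, hM⟩ := exists_between_of_card_eq_pow hp (m := b - 1) ha hb h.le
    (by omega) (by omega)
  refine ⟨M, normal_of_commutator_le hMB (hc.trans hAM), hAM, hMB, ?_⟩
  rw [relIndex_eq_pow hp (b := 1) hM (by rw [hb]; congr; omega) hMB, pow_one]

theorem commutator_le_of_index_prime (hp : p.Prime) (hG : IsPGroup p G) {U : Subgroup G}
    (hU : U.index = p) : commutator G ≤ U := by
  have : Fact p.Prime := ⟨hp⟩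
  have hnil := hG.isNilpotent
  have hn : U.Normal := by
    refine Subgroup.NormalizerCondition.normal_of_coatom U Group.normalizerCondition_of_isNilpotent
      ⟨?_, fun B hB => eq_top_of_lt_of_index_prime hp hU hB⟩
    rintro rfl
    rw [Subgroup.index_top] at hU
    exact hp.one_lt.ne hU
  have hcyc : IsCyclic (G ⧸ U) := isCyclic_of_prime_card (p := p) hU
  rw [commutator_def, Subgroup.commutator_le]
  intro g _ h _
  rw [← QuotientGroup.eq_one_iff]
  exact commutatorElement_eq_one_iff_mul_comm.2 (mul_comm' (g : G ⧸ U) h)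

theorem le_center_of_card_eq_prime (hp : p.Prime) (hG : IsPGroup p G) {Z : Subgroup G} [Z.Normal]
    (hZ : Nat.card Z = p) : Z ≤ Subgroup.center G := by
  have : Fact p.Prime := ⟨hp⟩
  have hnil := hG.isNilpotent
  have hne : Z ≠ ⊥ := by
    rintro rfl
    rw [Subgroup.card_bot] at hZ
    exact hp.one_lt.ne hZ
  obtain ⟨k, hk⟩ := exists_card_eq_pow hp hG ⁅Z, ⊤⁆
  have := lt_of_card_eq_pow hp hk (hZ.trans (pow_one p).symm) (commutator_top_lt hne)
  obtain rfl : k = 0 := by omega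
  rw [← Subgroup.centralizer_univ, ← Subgroup.coe_top,
    ← Subgroup.commutator_eq_bot_iff_le_centralizer, ← Subgroup.card_eq_one, hk, pow_zero]

end PGroup

end Commutators

/-! ### Nonabelian quotients of order p³ -/

section GroupTheory

variable {G : Type*} [Group G] {p : ℕ}

theorem ne_bot_of_card_eq_prime (hp : p.Prime) {K : Subgroup G}
    (hK : Nat.card K = p) : K ≠ ⊥ := by
  rintro rfl
  rw [Subgroup.card_bot] at hK
  exact hp.one_lt.ne hK

theorem map_mk'_le_center {B M : Subgroup G} [M.Normal] (h : ⁅B, ⊤⁆ ≤ M) :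
    B.map (QuotientGroup.mk' M) ≤ Subgroup.center (G ⧸ M) := by
  rintro _ ⟨b, hb, rfl⟩
  rw [Subgroup.mem_center_iff]
  intro x
  obtain ⟨g, rfl⟩ := QuotientGroup.mk'_surjective M x
  rw [eq_comm, ← commutatorElement_eq_one_iff_mul_comm, ← map_commutatorElement,
    ← MonoidHom.mem_ker, QuotientGroup.ker_mk']
  exact h (Subgroup.commutator_mem_commutator hb (Subgroup.mem_top g))

theorem card_map_mk' {B M : Subgroup G} [M.Normal] :
    Nat.card (B.map (QuotientGroup.mk' M)) = M.relIndex B := by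
  rw [← Subgroup.relIndex_ker, QuotientGroup.ker_mk']

theorem card_commutator_quotient {M : Subgroup G} [M.Normal] :
    Nat.card (commutator (G ⧸ M)) = M.relIndex (commutator G) := by
  rw [← map_commutator_of_surjective (QuotientGroup.mk'_surjective M), card_map_mk']

theorem commutator_quotient_le_center {M : Subgroup G} [M.Normal]
    (h : ⁅commutator G, ⊤⁆ ≤ M) : commutator (G ⧸ M) ≤ Subgroup.center (G ⧸ M) := by
  rw [← map_commutator_of_surjective (QuotientGroup.mk'_surjective M)]
  exact map_mk'_le_center h

theorem mk_mem_center_iff {M : Subgroup G} [M.Normal] {z : G} :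
    QuotientGroup.mk' M z ∈ Subgroup.center (G ⧸ M) ↔ ∀ g, ⁅z, g⁆ ∈ M := by
  rw [Subgroup.mem_center_iff, (QuotientGroup.mk'_surjective M).forall]
  refine forall_congr' fun g => ?_
  rw [eq_comm, ← commutatorElement_eq_one_iff_mul_comm, ← map_commutatorElement,
    ← MonoidHom.mem_ker, QuotientGroup.ker_mk']

variable [Finite G]

/-- The centre of a group with commutator subgroup of order `p` and an abelian subgroup of
index `p`. -/
theorem index_center_eq_prime_sq (hp : p.Prime) (hcard : Nat.card (commutator G) = p)
    (hcen : commutator G ≤ Subgroup.center G) {A : Subgroup G} (hA : A.index = p)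
    (hAA : ⁅A, A⁆ = ⊥) : Subgroup.center G ≤ A ∧ (Subgroup.center G).index = p ^ 2 := by
  obtain ⟨x, hx⟩ := exists_notMem_of_index_prime hp hA
  have hcomm : ∀ a ∈ A, ∀ b ∈ A, b * a = a * b := fun a ha b hb =>
    Subgroup.mem_centralizer_iff.1 (Subgroup.commutator_eq_bot_iff_le_centralizer.1 hAA ha) b hb
  have htop : ¬ A ≤ Subgroup.center G := by
    intro hle
    have h1 : (Subgroup.center G).index ∣ p := hA ▸ Subgroup.index_dvd_of_le hle
    refine ne_bot_of_card_eq_prime hp hcard ?_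
    rw [commutator_eq_bot_iff_center_eq_top]
    exact center_eq_top_of_index_dvd_prime hp h1
  have hle : Subgroup.center G ≤ A := by
    intro z hz
    by_contra hzA
    exact htop fun a ha => mem_center_of_index_prime hp hA hzA (fun b hb => hcomm a ha b hb)
      (Subgroup.mem_center_iff.1 hz a).symm
  -- As A is abelian and maximal, an element of A is central once it commutes with one `x` outside
  -- A.
  have heq : Subgroup.center G = Subgroup.centralizer {x} ⊓ A := by
    refine le_antisymm (le_inf (Subgroup.center_le_centralizer _) hle) ?_
    rintro a ⟨hax, ha⟩
    exact mem_center_of_index_prime hp hA hx (fun b hb => hcomm a ha b hb)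
      (Subgroup.mem_centralizer_singleton_iff.1 hax).symm
  have hrel : (Subgroup.center G).relIndex A = p := by
    have h1 : (Subgroup.center G).relIndex A ∣ p := by
      rw [heq, Subgroup.inf_relIndex_right, ← hcard]
      exact relIndex_centralizer_dvd x hcen fun b _ =>
        Subgroup.commutator_mem_commutator (Subgroup.mem_top _) (Subgroup.mem_top _)
    exact ((Nat.dvd_prime hp).1 h1).resolve_left fun h => htop (Subgroup.relIndex_eq_one.1 h)
  exact ⟨hle, by rw [← Subgroup.relIndex_mul_index hle, hrel, hA, sq]⟩

/-- A linear character of the centre that is nontrivial on G' has image of order p, since the centre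
has exponent dividing p. Its kernel is central, hence normal, has index p · p² in G and does not
contain G'. -/
theorem hasNonabelianQuotientOfCard_of_center (hp : p.Prime)
    (hcard : Nat.card (commutator G) = p) (hcen : commutator G ≤ Subgroup.center G)
    (hidx : (Subgroup.center G).index = p ^ 2) (hexp : ∀ z ∈ Subgroup.center G, z ^ p = 1) :
    HasNonabelianQuotientOfCard p G := by
  obtain ⟨c, hc, hc1⟩ := (Subgroup.ne_bot_iff_exists_ne_one (H := commutator G)).1
    (ne_bot_of_card_eq_prime hp hcard) |>.elim fun c h =>
      (⟨c.1, c.2, fun h' => h (Subtype.ext h')⟩ : ∃ c ∈ commutator G, c ≠ 1)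
  obtain ⟨φ, hφ⟩ := CommGroup.exists_apply_ne_one_of_hasEnoughRootsOfUnity (Subgroup.center G) ℂ
    (a := ⟨c, hcen hc⟩) (fun h => hc1 (congrArg Subtype.val h))
  have hfin : Finite φ.range := Finite.of_surjective _ φ.rangeRestrict_surjective
  have hcyc : IsCyclic φ.range := inferInstance
  have hrange : Nat.card φ.range = p := by
    obtain ⟨g, hg⟩ := hcyc.exists_generator
    have h1 : orderOf g ∣ p := by
      rw [orderOf_dvd_iff_pow_eq_one]
      obtain ⟨y, hy⟩ := φ.rangeRestrict_surjective g
      have hyp : y ^ p = 1 := Subtype.ext (hexp y y.2)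
      rw [← hy, ← map_pow, hyp, map_one]
    rw [← orderOf_eq_card_of_forall_mem_zpowers hg]
    refine ((Nat.dvd_prime hp).1 h1).resolve_left fun h => hφ ?_
    rw [orderOf_eq_one_iff] at h
    obtain ⟨k, hk⟩ := hg ⟨φ ⟨c, hcen hc⟩, _, rfl⟩
    simp only [h, one_zpow] at hk
    exact (congrArg Subtype.val hk).symm
  have hle : φ.ker.map (Subgroup.center G).subtype ≤ Subgroup.center G :=
    Subgroup.map_subtype_le _
  refine ⟨φ.ker.map (Subgroup.center G).subtype, ?_, ?_, fun h => hφ ?_⟩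
  · refine ⟨fun n hn g => ?_⟩
    rw [Subgroup.mem_center_iff.1 (hle hn) g, mul_inv_cancel_right]
    exact hn
  · have hsub : (φ.ker.map (Subgroup.center G).subtype).subgroupOf (Subgroup.center G) = φ.ker :=
      Subgroup.comap_map_eq_self_of_injective (Subgroup.center G).subtype_injective _
    rw [← Subgroup.relIndex_mul_index hle, hidx, Subgroup.relIndex, hsub, Subgroup.index_ker,
      hrange]
    ring
  · obtain ⟨y, hy, hyc⟩ := h hc
    rw [← (Subtype.ext hyc : y = ⟨c, hcen hc⟩)]
    exact hy

/-- The criterion used for producing nonabelian quotients of order `p ^ 3`. -/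
theorem hasNonabelianQuotientOfCard_of_relIndex (hp : p.Prime) {M U : Subgroup G} [M.Normal]
    (hMle : M ≤ commutator G) (hM : M.relIndex (commutator G) = p) (hc : ⁅commutator G, ⊤⁆ ≤ M)
    (hU : U.index = p) (hGU : commutator G ≤ U) (hUU : ⁅U, U⁆ ≤ M)
    (hz : ∀ z ∈ U, (∀ g, ⁅z, g⁆ ∈ M) → z ^ p ∈ M) : HasNonabelianQuotientOfCard p G := by
  have hsurj := QuotientGroup.mk'_surjective M
  have hcard : Nat.card (commutator (G ⧸ M)) = p := by rw [card_commutator_quotient, hM]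
  have hA : (U.map (QuotientGroup.mk' M)).index = p := by
    rw [Subgroup.index_map, QuotientGroup.ker_mk', sup_eq_left.2 (hMle.trans hGU),
      MonoidHom.range_eq_top.2 hsurj, Subgroup.index_top, mul_one, hU]
  have hAA : ⁅U.map (QuotientGroup.mk' M), U.map (QuotientGroup.mk' M)⁆ = ⊥ := by
    rw [← Subgroup.map_commutator, Subgroup.map_eq_bot_iff, QuotientGroup.ker_mk']
    exact hUU
  have hcen := commutator_quotient_le_center hc
  obtain ⟨hle, hidx⟩ := index_center_eq_prime_sq hp hcard hcen hA hAA
  refine (hasNonabelianQuotientOfCard_of_center hp hcard hcen hidx ?_).of_surjective hsurj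
  intro y hy
  obtain ⟨z, hzU, rfl⟩ := hle hy
  rw [← map_pow, ← MonoidHom.mem_ker, QuotientGroup.ker_mk']
  exact hz z hzU (mk_mem_center_iff.1 hy)

/-- The choice is M = Z(G) ∩ G'. For w outside U, the map c ↦ [w, c] from G' to γ₃ has kernel M, so
|G' : M| = p. -/
theorem hasNonabelianQuotientOfCard_of_le_centralizer (hp : p.Prime) (hG : IsPGroup p G)
    (hexp : ∀ x : G, x ^ p ∈ commutator G) (hγ : Nat.card (⁅commutator G, ⊤⁆ : Subgroup G) = p)
    {U : Subgroup G} (hU : U.index = p) (hUc : U ≤ Subgroup.centralizer (commutator G)) :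
    HasNonabelianQuotientOfCard p G := by
  have hγc := le_center_of_card_eq_prime hp hG hγ
  obtain ⟨w, hw⟩ := exists_notMem_of_index_prime hp hU
  have heq : Subgroup.center G ⊓ commutator G = Subgroup.centralizer {w} ⊓ commutator G := by
    refine le_antisymm (inf_le_inf_right _ (Subgroup.center_le_centralizer _)) ?_
    rintro c ⟨hcw, hc⟩
    exact ⟨mem_center_of_index_prime hp hU hw
      (fun u hu => (Subgroup.mem_centralizer_iff.1 (hUc hu) c hc).symm)
      (Subgroup.mem_centralizer_singleton_iff.1 hcw).symm, hc⟩
  have hMrel : (Subgroup.center G ⊓ commutator G).relIndex (commutator G) = p := by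
    have h1 : (Subgroup.center G ⊓ commutator G).relIndex (commutator G) ∣ p := by
      rw [heq, Subgroup.inf_relIndex_right, ← hγ]
      refine relIndex_centralizer_dvd w hγc fun b hb => ?_
      rw [Subgroup.commutator_comm]
      exact Subgroup.commutator_mem_commutator (Subgroup.mem_top w) hb
    refine ((Nat.dvd_prime hp).1 h1).resolve_left fun h => ?_
    refine ne_bot_of_card_eq_prime hp hγ ?_
    rw [Subgroup.commutator_eq_bot_iff_le_centralizer, Subgroup.coe_top,
      Subgroup.centralizer_univ]
    exact (Subgroup.relIndex_eq_one.1 h).trans inf_le_left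
  have hγM : ⁅commutator G, ⊤⁆ ≤ Subgroup.center G ⊓ commutator G :=
    le_inf hγc (Subgroup.commutator_le_left _ _)
  have hbot : ∀ K : Subgroup G, K ≤ commutator G → ⁅K, U⁆ = ⊥ := fun K hK => by
    rw [Subgroup.commutator_eq_bot_iff_le_centralizer]
    exact hK.trans (Subgroup.le_centralizer_iff.1 hUc)
  refine hasNonabelianQuotientOfCard_of_relIndex hp inf_le_right hMrel hγM hU
    (commutator_le_of_index_prime hp hG hU) (le_inf ?_ ?_) ?_
  -- Three subgroups lemma: [G, U] lies in G', which U centralizes, so [U, U] is central.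
  · rw [← Subgroup.centralizer_univ, ← Subgroup.coe_top,
      ← Subgroup.commutator_eq_bot_iff_le_centralizer]
    exact Subgroup.commutator_commutator_eq_bot_of_rotate
      (hbot _ (Subgroup.commutator_mono le_top le_rfl))
      (hbot _ (Subgroup.commutator_mono le_rfl le_top))
  · exact Subgroup.commutator_mono le_top le_top
  · intro z _ hz
    have hzc : ∀ g, ⁅z, g⁆ ∈ Subgroup.center G := fun g => (hz g).1
    refine Subgroup.mem_inf.2 ⟨?_, hexp z⟩
    rw [Subgroup.mem_center_iff]
    intro g
    have hcomm : ∀ h : G, Commute ⁅z, g⁆ h := fun h => (Subgroup.mem_center_iff.1 (hzc g) h).symm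
    -- [z^p, g] = [z, g]^p = [z, g^p], which is trivial since g^p ∈ G' and z centralizes G'.
    rw [eq_comm, ← commutatorElement_eq_one_iff_mul_comm, commutatorElement_pow_left (hcomm z),
      ← commutatorElement_pow_right (hcomm g), commutatorElement_eq_one_iff_mul_comm, eq_comm]
    exact Subgroup.mem_centralizer_singleton_iff.1
      (commutator_le_centralizer_singleton hzc (hexp g))

/-- Here C(U) ∩ G' is proper in G', so M can be taken to contain it. For z, u in U one has [z^p, u]
= [z, u]^p = 1 because [z, u] lies in γ₃, central of order p; hence z^p ∈ M. -/
theorem hasNonabelianQuotientOfCard_of_not_le_centralizer (hp : p.Prime) (hG : IsPGroup p G)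
    (hexp : ∀ x : G, x ^ p ∈ commutator G) (hγ : Nat.card (⁅commutator G, ⊤⁆ : Subgroup G) = p)
    {U : Subgroup G} (hU : U.index = p) (hUU : ⁅U, U⁆ ≤ ⁅commutator G, ⊤⁆)
    (hUc : ¬ U ≤ Subgroup.centralizer (commutator G)) : HasNonabelianQuotientOfCard p G := by
  have hγc := le_center_of_card_eq_prime hp hG hγ
  have hlt : Subgroup.centralizer U ⊓ commutator G < commutator G := by
    refine lt_of_le_of_ne inf_le_right fun h => hUc ?_
    rw [Subgroup.le_centralizer_iff]
    exact inf_eq_right.1 h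
  have hγD : ⁅commutator G, ⊤⁆ ≤ Subgroup.centralizer U ⊓ commutator G :=
    le_inf (hγc.trans (Subgroup.center_le_centralizer _)) (Subgroup.commutator_le_left _ _)
  obtain ⟨M, hMn, hDM, hMle, hMrel⟩ := exists_normal_relIndex_eq_prime hp hG hlt hγD
  refine hasNonabelianQuotientOfCard_of_relIndex hp hMle hMrel (hγD.trans hDM) hU
    (commutator_le_of_index_prime hp hG hU) (hUU.trans (hγD.trans hDM)) ?_
  intro z hz _
  refine hDM (Subgroup.mem_inf.2 ⟨?_, hexp z⟩)
  rw [Subgroup.mem_centralizer_iff]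
  intro u hu
  have hmem : ⁅z, u⁆ ∈ ⁅commutator G, (⊤ : Subgroup G)⁆ :=
    hUU (Subgroup.commutator_mem_commutator hz hu)
  have hpow : ⁅z, u⁆ ^ p = 1 := by
    have h1 := pow_card_eq_one' (x := (⟨⁅z, u⁆, hmem⟩ : (⁅commutator G, ⊤⁆ : Subgroup G)))
    rw [hγ] at h1
    exact congrArg Subtype.val h1
  rw [eq_comm, ← commutatorElement_eq_one_iff_mul_comm, commutatorElement_pow_left
    (Subgroup.mem_center_iff.1 (hγc hmem) z).symm, hpow]

/-- For a noncentral c in G', the centralizer U of c has index p. It centralizes γ₃ and c, which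
generate G' by order, so the case of U centralizing G' applies. -/
theorem hasNonabelianQuotientOfCard_of_card_commutator_eq_sq (hp : p.Prime) (hG : IsPGroup p G)
    (hexp : ∀ x : G, x ^ p ∈ commutator G) (hγ : Nat.card (⁅commutator G, ⊤⁆ : Subgroup G) = p)
    (hcard : Nat.card (commutator G) = p ^ 2) : HasNonabelianQuotientOfCard p G := by
  have hγc := le_center_of_card_eq_prime hp hG hγ
  obtain ⟨c, hc, hcz⟩ : ∃ c ∈ commutator G, c ∉ Subgroup.center G := by
    by_contra! h
    refine ne_bot_of_card_eq_prime hp hγ ?_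
    rw [Subgroup.commutator_eq_bot_iff_le_centralizer, Subgroup.coe_top, Subgroup.centralizer_univ]
    exact h
  have hU : (Subgroup.centralizer {c}).index = p := by
    refine ((Nat.dvd_prime hp).1 (hγ ▸ index_centralizer_dvd c hγc fun b =>
      Subgroup.commutator_mem_commutator hc (Subgroup.mem_top b))).resolve_left fun h => hcz ?_
    rw [Subgroup.index_eq_one] at h
    rw [Subgroup.mem_center_iff]
    intro g
    exact Subgroup.mem_centralizer_singleton_iff.1 (h ▸ Subgroup.mem_top g)
  refine hasNonabelianQuotientOfCard_of_le_centralizer hp hG hexp hγ hU ?_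
  rw [Subgroup.le_centralizer_iff]
  have hlt : ⁅commutator G, ⊤⁆ <
      Subgroup.centralizer (Subgroup.centralizer {c} : Set G) ⊓ commutator G := by
    refine lt_of_le_of_ne (le_inf (hγc.trans (Subgroup.center_le_centralizer _))
      (Subgroup.commutator_le_left _ _)) fun h => hcz (hγc ?_)
    rw [h]
    refine Subgroup.mem_inf.2 ⟨?_, hc⟩
    rw [Subgroup.mem_centralizer_iff]
    exact fun u hu => Subgroup.mem_centralizer_singleton_iff.1 hu
  obtain ⟨k, hk⟩ := exists_card_eq_pow hp hG
    (Subgroup.centralizer (Subgroup.centralizer {c} : Set G) ⊓ commutator G)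
  have h1 := lt_of_card_eq_pow hp (hγ.trans (pow_one p).symm) hk hlt
  have h2 := Subgroup.eq_of_le_of_card_ge (inf_le_right :
    Subgroup.centralizer (Subgroup.centralizer {c} : Set G) ⊓ commutator G ≤ _)
    (by rw [hk, hcard]; exact Nat.pow_le_pow_right hp.pos h1)
  exact inf_eq_right.1 h2

/-- The centralizer A of a noncentral h has order p³, and its centre contains G' and h, hence has
index at most p in A. So A is abelian of index p. -/
theorem index_center_eq_prime_sq_of_card (hp : p.Prime) (hG : Nat.card G = p ^ 4)
    (hcard : Nat.card (commutator G) = p) (hcen : commutator G ≤ Subgroup.center G) :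
    (Subgroup.center G).index = p ^ 2 := by
  have : Fact p.Prime := ⟨hp⟩
  have hpG : IsPGroup p G := IsPGroup.of_card hG
  have hmem : ∀ g h : G, ⁅g, h⁆ ∈ commutator G := fun g h =>
    Subgroup.commutator_mem_commutator (Subgroup.mem_top _) (Subgroup.mem_top _)
  obtain ⟨h, hh⟩ : ∃ h, h ∉ Subgroup.center G := by
    by_contra! H
    refine ne_bot_of_card_eq_prime hp hcard ?_
    rw [commutator_eq_bot_iff_center_eq_top]
    exact (Subgroup.eq_top_iff' _).2 H
  have hA : (Subgroup.centralizer {h}).index = p := by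
    refine ((Nat.dvd_prime hp).1 (hcard ▸ index_centralizer_dvd h hcen (hmem h))).resolve_left
      fun h1 => hh ?_
    rw [Subgroup.index_eq_one] at h1
    rw [Subgroup.mem_center_iff]
    intro g
    exact Subgroup.mem_centralizer_singleton_iff.1 (h1 ▸ Subgroup.mem_top g)
  set A := Subgroup.centralizer {h}
  have hAcard : Nat.card A = p ^ 3 := by
    have h1 := Subgroup.card_mul_index A
    rw [hA, hG, pow_succ] at h1
    exact Nat.eq_of_mul_eq_mul_right hp.pos h1
  have hlt : commutator G < Subgroup.centralizer A ⊓ A := by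
    refine lt_of_le_of_ne (le_inf (hcen.trans (Subgroup.center_le_centralizer _))
      (hcen.trans (Subgroup.center_le_centralizer _))) fun h1 => hh (hcen ?_)
    rw [h1]
    refine Subgroup.mem_inf.2 ⟨?_, Subgroup.mem_centralizer_singleton_iff.2 rfl⟩
    rw [Subgroup.mem_centralizer_iff]
    exact fun u hu => Subgroup.mem_centralizer_singleton_iff.1 hu
  obtain ⟨k, hk⟩ := exists_card_eq_pow hp hpG (Subgroup.centralizer A ⊓ A)
  have h1 := lt_of_card_eq_pow hp (hcard.trans (pow_one p).symm) hk hlt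
  have hk3 : k ≤ 3 := by
    have := Subgroup.card_dvd_of_le (inf_le_right : Subgroup.centralizer A ⊓ A ≤ A)
    rw [hk, hAcard] at this
    exact (Nat.pow_dvd_pow_iff_le_right hp.one_lt).1 this
  refine (index_center_eq_prime_sq hp hcard hcen hA
    (commutator_eq_bot_of_relIndex_dvd_prime hp (S := Subgroup.centralizer A ⊓ A) ?_ ?_)).2
  · rw [Subgroup.le_centralizer_iff]
    exact inf_le_left
  · rw [relIndex_eq_pow hp (b := 3 - k) hk (by rw [hAcard, Nat.add_sub_of_le hk3]) inf_le_right]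
    exact (pow_dvd_pow p (by omega : 3 - k ≤ 1)).trans (pow_one p).dvd

/-- U is the preimage of an abelian subgroup T of order p⁴ in G/γ₃, a group of order p⁵. T is found
in the centralizer of an element that is central modulo a suitable M but lies outside G'. -/
theorem exists_index_eq_prime_commutator_le (hp : p.Prime) (hG : Nat.card G = p ^ 6)
    (hγ : Nat.card (⁅commutator G, ⊤⁆ : Subgroup G) = p) (hcard : Nat.card (commutator G) = p ^ 3) :
    ∃ U : Subgroup G, U.index = p ∧ ⁅U, U⁆ ≤ ⁅commutator G, ⊤⁆ := by
  have : Fact p.Prime := ⟨hp⟩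
  have hpG : IsPGroup p G := IsPGroup.of_card hG
  have hγle : ⁅commutator G, ⊤⁆ ≤ commutator G := Subgroup.commutator_le_left _ _
  have hlt : ⁅commutator G, ⊤⁆ < commutator G := by
    refine lt_of_le_of_ne hγle fun h => ?_
    rw [h, hcard] at hγ
    exact absurd (Nat.pow_right_injective hp.two_le (hγ.trans (pow_one p).symm)) (by norm_num)
  obtain ⟨M, hMn, hγM, hMle, hMrel⟩ := exists_normal_relIndex_eq_prime hp hpG hlt le_rfl
  have hMcard : Nat.card M = p ^ 2 := by
    have h1 := Subgroup.card_mul_index (M.subgroupOf (commutator G))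
    rw [Nat.card_congr (Subgroup.subgroupOfEquivOfLe hMle).toEquiv, ← Subgroup.relIndex, hMrel,
      hcard, pow_succ] at h1
    exact Nat.eq_of_mul_eq_mul_right hp.pos h1
  -- G/M has order p⁴ and a centre of order p², too large to fit in its commutator subgroup of order
  -- p.
  obtain ⟨z, hzM, hzG⟩ : ∃ z, (∀ g, ⁅z, g⁆ ∈ M) ∧ z ∉ commutator G := by
    by_contra! H
    have hHcard : Nat.card (G ⧸ M) = p ^ 4 := index_eq_pow hp hMcard hG
    have hHc : Nat.card (commutator (G ⧸ M)) = p := by rw [card_commutator_quotient, hMrel]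
    have hidx := index_center_eq_prime_sq_of_card hp hHcard hHc
      (commutator_quotient_le_center hγM)
    have hle : Subgroup.center (G ⧸ M) ≤ commutator (G ⧸ M) := by
      intro y hy
      obtain ⟨z, rfl⟩ := QuotientGroup.mk'_surjective M y
      rw [← map_commutator_of_surjective (QuotientGroup.mk'_surjective M)]
      exact Subgroup.mem_map_of_mem _ (H z (mk_mem_center_iff.1 hy))
    have h1 := Subgroup.card_mul_index (Subgroup.center (G ⧸ M))
    have h2 := Nat.le_of_dvd hp.pos (hHc ▸ Subgroup.card_dvd_of_le hle)
    rw [hidx, hHcard] at h1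
    have h3 : p ^ 4 ≤ p ^ 3 := by
      rw [← h1, pow_succ' p 2]
      exact Nat.mul_le_mul_right _ h2
    exact absurd ((Nat.pow_le_pow_iff_right hp.one_lt).1 h3) (by norm_num)
  set Γ := ⁅commutator G, (⊤ : Subgroup G)⁆
  let q := QuotientGroup.mk' Γ
  have hq : Function.Surjective q := QuotientGroup.mk'_surjective Γ
  have hQ : Nat.card (G ⧸ Γ) = p ^ 5 := index_eq_pow hp (hγ.trans (pow_one p).symm) hG
  have hpQ : IsPGroup p (G ⧸ Γ) := IsPGroup.of_card hQ
  have hQ' : Nat.card (commutator (G ⧸ Γ)) = p ^ 2 := by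
    rw [card_commutator_quotient, relIndex_eq_pow hp (b := 2) (hγ.trans (pow_one p).symm) hcard hγle]
  have hcen : commutator (G ⧸ Γ) ≤ Subgroup.center (G ⧸ Γ) := commutator_quotient_le_center le_rfl
  have hC : (Subgroup.centralizer {q z}).index ∣ p := by
    have h1 : M.map q ≤ Subgroup.center (G ⧸ Γ) :=
      map_mk'_le_center (Subgroup.commutator_mono hMle le_rfl)
    have h2 : Nat.card (M.map q) = p := by
      rw [card_map_mk', relIndex_eq_pow hp (b := 1) (hγ.trans (pow_one p).symm) hMcard hγM,
        pow_one]
    refine h2 ▸ index_centralizer_dvd (q z) h1 fun b => ?_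
    obtain ⟨g, rfl⟩ := hq b
    rw [← map_commutatorElement]
    exact Subgroup.mem_map_of_mem q (hzM g)
  set C := Subgroup.centralizer {q z}
  obtain ⟨c, hc⟩ := exists_card_eq_pow hp hpQ C
  have hc4 : 4 ≤ c := by
    have h1 := Subgroup.card_mul_index C
    have h2 : p ^ 5 ≤ p ^ (c + 1) := by
      rw [← hQ, ← h1, hc, pow_succ]
      exact Nat.mul_le_mul_left _ (Nat.le_of_dvd hp.pos hC)
    have := (Nat.pow_le_pow_iff_right hp.one_lt).1 h2
    omega
  -- The centre of C also contains the image of z, so its order is at least p³. This leaves room for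
  -- a central S of order p³ and a T of order p⁴ above it, abelian because |T : S| = p.
  have hlt' : commutator (G ⧸ Γ) < Subgroup.centralizer C ⊓ C := by
    refine lt_of_le_of_ne (le_inf (hcen.trans (Subgroup.center_le_centralizer _))
      (hcen.trans (Subgroup.center_le_centralizer _))) fun h1 => hzG ?_
    have h2 : q z ∈ commutator (G ⧸ Γ) := by
      rw [h1]
      refine Subgroup.mem_inf.2 ⟨?_, Subgroup.mem_centralizer_singleton_iff.2 rfl⟩
      rw [Subgroup.mem_centralizer_iff]
      exact fun u hu => Subgroup.mem_centralizer_singleton_iff.1 hu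
    rw [← map_commutator_of_surjective hq, ← Subgroup.mem_comap, Subgroup.comap_map_eq,
      QuotientGroup.ker_mk', sup_eq_left.2 hγle] at h2
    exact h2
  obtain ⟨s, hs⟩ := exists_card_eq_pow hp hpQ (Subgroup.centralizer C ⊓ C)
  have hs3 := lt_of_card_eq_pow hp hQ' hs hlt'
  obtain ⟨S, -, hSle, hS⟩ := exists_between_of_card_eq_pow hp (m := 3) hQ' hs hlt'.le
    (by norm_num) (by omega)
  obtain ⟨T, hST, hTC, hT⟩ := exists_between_of_card_eq_pow hp (m := 4) hS hc
    (hSle.trans inf_le_right) (by norm_num) hc4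
  have hTT : ⁅T, T⁆ = ⊥ := by
    refine commutator_eq_bot_of_relIndex_dvd_prime hp (S := S) ?_
      (by rw [relIndex_eq_pow hp (b := 1) hS hT hST, pow_one])
    rw [Subgroup.le_centralizer_iff]
    exact (hSle.trans inf_le_left).trans (Subgroup.centralizer_le hTC)
  refine ⟨T.comap q, ?_, ?_⟩
  · rw [T.index_comap_of_surjective hq, index_eq_pow hp (b := 1) hT hQ, pow_one]
  · have h1 : ⁅T.comap q, T.comap q⁆.map q = ⊥ := by
      rw [Subgroup.map_commutator, Subgroup.map_comap_eq_self_of_surjective hq, hTT]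
    rw [Subgroup.map_eq_bot_iff, QuotientGroup.ker_mk'] at h1
    exact h1

/-- A group of order `p ^ 6` and class at least three whose abelianization has exponent `p` has a
nonabelian quotient of order `p ^ 3`. -/
theorem hasNonabelianQuotientOfCard_of_card_eq_pow_six (hp : p.Prime) (hG : Nat.card G = p ^ 6)
    (hexp : ∀ x : G, x ^ p ∈ commutator G) (hγ : ⁅commutator G, (⊤ : Subgroup G)⁆ ≠ ⊥) :
    HasNonabelianQuotientOfCard p G := by
  have : Fact p.Prime := ⟨hp⟩
  have hpG : IsPGroup p G := IsPGroup.of_card hG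
  have hnil := hpG.isNilpotent
  have hne : commutator G ≠ ⊥ := by
    intro h
    rw [h, Subgroup.commutator_bot_left] at hγ
    exact hγ rfl
  have hlt := commutator_top_lt hne
  obtain ⟨k, hk⟩ := exists_card_eq_pow hp hpG (commutator G)
  obtain ⟨m, hm⟩ := exists_card_eq_pow hp hpG ⁅commutator G, ⊤⁆
  have hmk := lt_of_card_eq_pow hp hm hk hlt
  have hm0 : m ≠ 0 := by
    rintro rfl
    exact hγ (Subgroup.card_eq_one.1 hm)
  have hk6 : k ≤ 6 := by
    have := Subgroup.card_subgroup_dvd_card (commutator G)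
    rw [hk, hG] at this
    exact (Nat.pow_dvd_pow_iff_le_right hp.one_lt).1 this
  have hidx : (commutator G).index = p ^ (6 - k) :=
    index_eq_pow hp hk (by rw [hG, Nat.add_sub_of_le hk6])
  obtain ⟨M, hMn, hγM, hMle, hMrel⟩ := exists_normal_relIndex_eq_prime hp hpG hlt le_rfl
  have hnle : ¬ commutator G ≤ M := by
    intro h
    rw [Subgroup.relIndex_eq_one.2 h] at hMrel
    exact hp.one_lt.ne hMrel
  -- If |G : G'| divided p, the centre of G/M would have index dividing p, making G/M abelian
  -- although G' is not inside M.
  have hk4 : k ≤ 4 := by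
    by_contra! hk5
    have h1 : (commutator (G ⧸ M)).index ∣ p := by
      rw [← map_commutator_of_surjective (QuotientGroup.mk'_surjective M), Subgroup.index_map,
        QuotientGroup.ker_mk', sup_eq_left.2 hMle,
        MonoidHom.range_eq_top.2 (QuotientGroup.mk'_surjective M), Subgroup.index_top, mul_one,
        hidx]
      exact (pow_dvd_pow p (by omega : 6 - k ≤ 1)).trans (pow_one p).dvd
    have h2 := center_eq_top_of_index_dvd_prime hp
      ((Subgroup.index_dvd_of_le (commutator_quotient_le_center hγM)).trans h1)
    rw [← commutator_eq_bot_iff_center_eq_top, ← Subgroup.card_eq_one, card_commutator_quotient,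
      hMrel] at h2
    exact hp.one_lt.ne' h2
  rcases (by omega : k = 4 ∨ k = 2 ∨ (k = 3 ∧ m = 1) ∨ (k = 3 ∧ m = 2)) with
    rfl | rfl | ⟨rfl, rfl⟩ | ⟨rfl, rfl⟩
  · exact ⟨M, hMn, by rw [← Subgroup.relIndex_mul_index hMle, hMrel, hidx]; ring, hnle⟩
  · obtain rfl : m = 1 := by omega
    exact hasNonabelianQuotientOfCard_of_card_commutator_eq_sq hp hpG hexp (by rw [hm, pow_one]) hk
  · rw [pow_one] at hm
    obtain ⟨U, hU, hUU⟩ := exists_index_eq_prime_commutator_le hp hG hm hk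
    by_cases hUc : U ≤ Subgroup.centralizer (commutator G)
    · exact hasNonabelianQuotientOfCard_of_le_centralizer hp hpG hexp hm hU hUc
    · exact hasNonabelianQuotientOfCard_of_not_le_centralizer hp hpG hexp hm hU hUU hUc
  -- Modulo L the orders of G' and γ₃ drop from p³ and p² to p² and p.
  · obtain ⟨L, hLn, -, hLle, hLrel⟩ := exists_normal_relIndex_eq_prime hp hpG
      (commutator_top_lt hγ) le_rfl
    have hsurj := QuotientGroup.mk'_surjective L
    refine (hasNonabelianQuotientOfCard_of_card_commutator_eq_sq hp (hpG.to_quotient L)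
      ?_ ?_ ?_).of_surjective hsurj
    · intro y
      obtain ⟨x, rfl⟩ := hsurj y
      rw [← map_pow, ← map_commutator_of_surjective hsurj]
      exact Subgroup.mem_map_of_mem _ (hexp x)
    · rw [← map_commutator_of_surjective hsurj, ← Subgroup.map_top_of_surjective _ hsurj,
        ← Subgroup.map_commutator, card_map_mk', hLrel]
    · rw [card_commutator_quotient, ← Subgroup.relIndex_mul_relIndex _ _ _ hLle hlt.le, hLrel,
        relIndex_eq_pow hp (b := 1) hm hk hlt.le]
      ring

end GroupTheory

end Codegree

theorem mainTheorem4 {G : Type*} [Group G] [Finite G] (p : ℕ) (hp : p.Prime)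
    (hcard : Nat.card G = p ^ 6) (hclass : 3 ≤ Group.nilpotencyClass G) :
    (p : ℂ) ^ 2 ∈ Codegree.cod G := by
  have : Fact p.Prime := ⟨hp⟩
  have hpG : IsPGroup p G := IsPGroup.of_card hcard
  have hnil := hpG.isNilpotent
  by_cases hexp : ∀ x : G, x ^ p ∈ commutator G
  · have hγ : ⁅commutator G, (⊤ : Subgroup G)⁆ ≠ ⊥ := by
      intro h
      -- The series is indexed from 0, so its term 2 is γ₃.
      have h2 : (⊤ : Subgroup G).lowerCentralSeries 2 = ⊥ := h
      rw [Subgroup.lowerCentralSeries_eq_bot_iff_nilpotencyClass_le] at h2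
      omega
    obtain ⟨N, hN, hidx, hc⟩ :=
      Codegree.hasNonabelianQuotientOfCard_of_card_eq_pow_six hp hcard hexp hγ
    exact Codegree.sq_mem_cod_of_index_eq_prime_pow_three hp N hidx hc
  · push Not at hexp
    obtain ⟨x, hx⟩ := hexp
    exact Codegree.sq_mem_cod_of_pow_notMem_commutator hp hpG hx
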